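/- Let $N\ge 1$, $n,r\ge 0$, let $A\in\mathbb R^{n\times n}$, $B\in\mathbb R^{n\times r}$, $C\in\mathbb R^{r\times n}$, let $\mathcal G_{\rm sys}$ be a digraph without self-loops on $\{1,\dots,N\}$ with edge set $\mathcal E$, and let $\mathcal I_u\subseteq\{1,\dots,N\}$ be a set of driving vertices. Let $p=(p_e)_{e\in\mathcal E}$ be indeterminates, put $l_{ij}=p_{(j,i)}$ if $(j,i)\in\mathcal E$ and $l_{ij}=0$ otherwise ($i\neq j$), and let $L=L(p)$ be the weighted Laplacian with $L_{ij}=-l_{ij}$ for $i\ne j$ and $L_{ii}=\sum_{j\neq i}l_{ij}$. Consider the networked system with $r$ equally weighted channels ($L_1=\dots=L_r=L$), $$\dot x=A_{\rm sys}(p)\,x+B_{\rm sys}\,u,\qquad A_{\rm sys}(p)=I_N\otimes A-L(p)\otimes BC,\qquad B_{\rm sys}=\Delta\otimes B,$$ where the columns of $\Delta$ are the standard unit vectors $e_i\in\mathbb R^N$, $i\in\mathcal I_u$. The system is called structurally controllable if there are real values of the weights $p$ (zero values allowed) for which $(A_{\rm sys}(p),B_{\rm sys})$ is controllable. Let $\Gamma\in\mathbb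 R[s,p]$ be the greatest common divisor of all $nN\times nN$ minors of $[sI-A_{\rm sys}(p),\,B_{\rm sys}]$; the system is said to have a parameter-dependent uncontrollable mode if $\Gamma$ has a non-constant factor in $\mathbb R[s,p]$ that is not divisible by any polynomial $\beta(s)\in\mathbb R[s]$ of degree at least $1$. The generic rank of a matrix depending on $p$ is the maximum of its rank over all real values of $p$. Suppose that $\mathcal G_{\rm sys}$ has a (directed) spanning tree rooted at some vertex of $\mathcal I_u$. Then the system has no parameter-dependent uncontrollable mode. Moreover, the system is structurally controllable if and only if for every (complex) eigenvalue $\lambda$ of $A$ the matrix $$\bigl[\lambda I_{nN}-I_N\otimes A+L(p)\otimes BC,\ \ \Delta\otimes B\bigr]$$ has full row generic rank, i.e. generic rank $nN$. -/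

import Mathlib

open scoped Kronecker

noncomputable section

namespace NRCS

/-! ### Linear control systems -/

/-- The linear system `x' = A x + B u` is controllable: every initial state can be steered to every
final state in some finite time `T > 0` by a (continuous) input. -/
def Controllable {ι κ : Type*} [Fintype ι] [Fintype κ]
    (A : Matrix ι ι ℝ) (B : Matrix ι κ ℝ) : Prop :=
  ∀ x₀ x₁ : ι → ℝ, ∃ T : ℝ, 0 < T ∧ ∃ (u : ℝ → κ → ℝ) (x : ℝ → ι → ℝ), Continuous u ∧
    (∀ t, HasDerivAt x (A.mulVec (x t) + B.mulVec (u t)) t) ∧ x 0 = x₀ ∧ x T = x₁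

/-! ### Plants depending polynomially on parameters

The ring `R[s,p]` is represented as `(MvPolynomial σ ℝ)[X]`, with `s` the outer variable. -/

/-- `α(s)` is an `s`-factor of `a(s,p)`: it divides `a(s,p)` and has degree at least one. -/
def IsSFactor {σ : Type*} (α : Polynomial ℝ) (a : Polynomial (MvPolynomial σ ℝ)) : Prop :=
  α.map (MvPolynomial.C : ℝ →+* MvPolynomial σ ℝ) ∣ a ∧ 1 ≤ α.natDegree

/-- `α(s,p)` is a (nontrivial) `(s,p)`-factor of `a(s,p)`: it divides `a(s,p)`, it has no
`s`-factor, and it is not a nonzero constant. -/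
def IsSPFactor {σ : Type*} (α a : Polynomial (MvPolynomial σ ℝ)) : Prop :=
  α ∣ a ∧ (∀ β : Polynomial ℝ, ¬ IsSFactor β α) ∧ ¬ IsUnit α

/-- The matrix `[sI - A(p), B(p)]` over `R[s,p]`. -/
def pencil {σ ι κ : Type*} [Fintype ι] [DecidableEq ι]
    (A : Matrix ι ι (MvPolynomial σ ℝ)) (B : Matrix ι κ (MvPolynomial σ ℝ)) :
    Matrix ι (ι ⊕ κ) (Polynomial (MvPolynomial σ ℝ)) :=
  Matrix.fromCols (Matrix.charmatrix A) (B.map Polynomial.C)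

/-- `Γ(M)`: the greatest common divisor of the maximal (full row) minors of `M` (it is determined
up to a unit; the choice of columns is an injection, whose order affects only signs). -/
def minorGcd {σ ι κ : Type*} [Fintype ι] [DecidableEq ι] [Fintype κ]
    (M : Matrix ι κ (Polynomial (MvPolynomial σ ℝ))) : Polynomial (MvPolynomial σ ℝ) :=
  letI : NormalizedGCDMonoid (Polynomial (MvPolynomial σ ℝ)) := Classical.choice inferInstance
  letI : DecidableEq κ := Classical.decEq κ
  (Finset.univ : Finset (ι ↪ κ)).gcd fun f => (M.submatrix id f).det

theorem dvd_minorGcd_iff {σ ι κ : Type*} [Fintype ι] [DecidableEq ι] [Fintype κ]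
    (M : Matrix ι κ (Polynomial (MvPolynomial σ ℝ))) (d : Polynomial (MvPolynomial σ ℝ)) :
    d ∣ minorGcd M ↔ ∀ f : ι ↪ κ, d ∣ (M.submatrix id f).det := by
  let : NormalizedGCDMonoid (Polynomial (MvPolynomial σ ℝ)) := Classical.choice inferInstance
  let : DecidableEq κ := Classical.decEq κ
  unfold minorGcd
  exact Finset.dvd_gcd_iff.trans (by simp)

/-- The plant `(A(p), B(p))` has a parameter-dependent uncontrollable mode:
`Γ([sI - A(p), B(p)])` has an `(s,p)`-factor. -/
def HasParamDependentUncontrollableMode {σ ι κ : Type*} [Fintype ι] [DecidableEq ι] [Fintype κ]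
    (A : Matrix ι ι (MvPolynomial σ ℝ)) (B : Matrix ι κ (MvPolynomial σ ℝ)) : Prop :=
  ∃ α, IsSPFactor α (minorGcd (pencil A B))

/-- The generic rank of a matrix depending on real parameters `p`: the maximal rank that the matrix
attains as `p` varies. -/
def genericRank {σ ι κ : Type*} [Fintype ι] [Fintype κ]
    (M : (σ → ℝ) → Matrix ι κ ℂ) : ℕ :=
  ⨆ p : σ → ℝ, (M p).rank

theorem rank_le_genericRank {σ ι κ : Type*} [Fintype ι] [Fintype κ]
    (M : (σ → ℝ) → Matrix ι κ ℂ) (p : σ → ℝ) : (M p).rank ≤ genericRank M :=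
  le_ciSup (f := fun p => (M p).rank)
    ⟨Fintype.card κ, by rintro _ ⟨q, rfl⟩; exact (M q).rank_le_card_width⟩ p

theorem exists_rank_eq_genericRank {σ ι κ : Type*} [Fintype ι] [Fintype κ]
    (M : (σ → ℝ) → Matrix ι κ ℂ) : ∃ p, (M p).rank = genericRank M :=
  Nat.sSup_mem (s := Set.range fun p => (M p).rank) ⟨_, 0, rfl⟩
    ⟨Fintype.card κ, by rintro _ ⟨q, rfl⟩; exact (M q).rank_le_card_width⟩

/-! ### Networks of relatively coupled systems -/

/-- The edges of the interaction digraph; `(i, j)` is an edge if subsystem `j` is directly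
influenced by subsystem `i`. -/
abbrev Edge {N : ℕ} (G : Digraph (Fin N)) : Type := {e : Fin N × Fin N // G.Adj e.1 e.2}

open Classical in
/-- The weight `l_ij` of the influence of subsystem `j` on subsystem `i`: a free value on the edge
`(j, i)`, and zero if `(j, i)` is not an edge. -/
def weight {N : ℕ} {R : Type*} [CommRing R] (G : Digraph (Fin N)) (w : Edge G → R)
    (i j : Fin N) : R :=
  if h : G.Adj j i then w ⟨(j, i), h⟩ else 0

/-- The weighted Laplacian: `L_ij = -l_ij` for `i ≠ j` and `L_ii = ∑_{j ≠ i} l_ij`. -/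
def laplacian {N : ℕ} {R : Type*} [CommRing R] (G : Digraph (Fin N)) (w : Edge G → R) :
    Matrix (Fin N) (Fin N) R :=
  Matrix.of fun i j =>
    if i = j then ∑ k ∈ Finset.univ.erase i, weight G w i k else - weight G w i j

/-- `A_sys = I_N ⊗ A - ∑_k L_k ⊗ (b_k c_k)`, with `b_k` the columns of `B` and `c_k` the rows
of `C`. -/
def sysA {N n r : ℕ} {R : Type*} [CommRing R] (A : Matrix (Fin n) (Fin n) R)
    (B : Matrix (Fin n) (Fin r) R) (C : Matrix (Fin r) (Fin n) R)
    (L : Fin r → Matrix (Fin N) (Fin N) R) : Matrix (Fin N × Fin n) (Fin N × Fin n) R :=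
  (1 : Matrix (Fin N) (Fin N) R) ⊗ₖ A
    - ∑ k : Fin r, L k ⊗ₖ Matrix.vecMulVec (fun i => B i k) (C k)

/-- `Δ`: the matrix whose columns are the unit vectors `e_i`, for `i` in the set `I` of driving
vertices. -/
def inputSelector {N : ℕ} (R : Type*) [CommRing R] (I : Finset (Fin N)) :
    Matrix (Fin N) {i : Fin N // i ∈ I} R :=
  Matrix.of fun j i => if j = i.1 then 1 else 0

/-- `B_sys = Δ ⊗ B`. -/
def sysB {N n r : ℕ} {R : Type*} [CommRing R] (I : Finset (Fin N))
    (B : Matrix (Fin n) (Fin r) R) : Matrix (Fin N × Fin n) ({i : Fin N // i ∈ I} × Fin r) R :=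
  inputSelector R I ⊗ₖ B

/-- Structural controllability in the equally weighted case `L_1 = ⋯ = L_r`: some choice of real
edge weights, common to all channels, makes the lumped system controllable. -/
def StructurallyControllable {N n r : ℕ} (G : Digraph (Fin N)) (I : Finset (Fin N))
    (A : Matrix (Fin n) (Fin n) ℝ) (B : Matrix (Fin n) (Fin r) ℝ)
    (C : Matrix (Fin r) (Fin n) ℝ) : Prop :=
  ∃ w : Edge G → ℝ, Controllable (sysA A B C fun _ => laplacian G w) (sysB I B)

/-- The network with equally weighted channels, with the edge weights as indeterminates, has a
parameter-dependent uncontrollable mode. -/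
def HasParamUncontrollableMode {N n r : ℕ} (G : Digraph (Fin N)) (I : Finset (Fin N))
    (A : Matrix (Fin n) (Fin n) ℝ) (B : Matrix (Fin n) (Fin r) ℝ)
    (C : Matrix (Fin r) (Fin n) ℝ) : Prop :=
  HasParamDependentUncontrollableMode (σ := Edge G)
    (sysA (A.map MvPolynomial.C) (B.map MvPolynomial.C) (C.map MvPolynomial.C)
      fun _ => laplacian G MvPolynomial.X)
    (sysB I (B.map MvPolynomial.C))

/-- The matrix `[λ I - I_N ⊗ A + L ⊗ BC, Δ ⊗ B]`, as a function of the real edge weights. -/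
def modeMatrix {N n r : ℕ} (G : Digraph (Fin N)) (I : Finset (Fin N))
    (A : Matrix (Fin n) (Fin n) ℝ) (B : Matrix (Fin n) (Fin r) ℝ)
    (C : Matrix (Fin r) (Fin n) ℝ) (lam : ℂ) (w : Edge G → ℝ) :
    Matrix (Fin N × Fin n) ((Fin N × Fin n) ⊕ ({i : Fin N // i ∈ I} × Fin r)) ℂ :=
  Matrix.fromCols
    (lam • (1 : Matrix (Fin N × Fin n) (Fin N × Fin n) ℂ)
      - (1 : Matrix (Fin N) (Fin N) ℂ) ⊗ₖ A.map Complex.ofReal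
      + (laplacian G w).map Complex.ofReal ⊗ₖ (B * C).map Complex.ofReal)
    (inputSelector ℂ I ⊗ₖ B.map Complex.ofReal)

/-- `G` has a spanning tree rooted at `root`: a set of `N - 1` edges along which every vertex can be
reached from `root`. -/
def HasSpanningTreeRootedAt {N : ℕ} (G : Digraph (Fin N)) (root : Fin N) : Prop :=
  ∃ T : Finset (Fin N × Fin N), (∀ e ∈ T, G.Adj e.1 e.2) ∧ T.card + 1 = N ∧
    ∀ v, Relation.ReflTransGen (fun i j => (i, j) ∈ T) root v

end NRCS

end

/-!
The argument rests on one fact: under the spanning tree hypothesis, away from the eigenvalues of `A`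
the matrix `[λI - A_sys(p), B_sys]` has full row rank for all weights `p` at which a polynomial,
independent of `λ`, does not vanish. So every uncontrollable mode that persists for generic weights
is a fixed number, an eigenvalue of `A`.

To see this, write a left kernel vector as an `n × N` matrix `X` and put `Y = Bᵀ X`. If `λ` is not an
eigenvalue of `A`, solving the kernel equation for `X` yields `Y = H Y L` for some matrix `H`, and
`B_sys` forces the column of `Y` at the root to vanish. The row space of `Y` is then contained in its
own image under `L`, hence, by dimension, is `L`-invariant, and it is orthogonal to `e_root`; if the
Krylov matrix `[e, L e, …, L^(N-1) e]` of `e = e_root` is nonsingular, then `Y = 0` and `X = 0`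
(`eq_zero_of_vecMul_hautusMatrix`). The Krylov determinant is a nonzero polynomial in the weights: put
pairwise distinct weights on a tree of parents and zero elsewhere; every left eigenvector found by
walking from a vertex towards the root is nonzero at the root, and the Krylov matrix is diagonalised
into a Vandermonde matrix (`exists_weight_det_krylov_ne_zero`).

For the absence of parameter-dependent modes this fact is applied over an algebraic closure of
`ℝ(p)`. A factor of `Γ` without `s`-factor divides the monic characteristic polynomial, and has a
root there that is not an eigenvalue of `A`: otherwise it would divide a power of `det(sI - A)`, and
would then be a polynomial in `s` alone (`IsSPFactor.exists_root`).

For structural controllability it is applied over `ℂ`, together with the Hautus test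
(`controllable_iff_hautus`), which is proved here for controllability in terms of trajectories. The
finitely many eigenvalues of `A` and the Krylov determinant each give a nonzero polynomial in the
weights, and some real point avoids the zeros of all of them.
-/

namespace NRCS

open Polynomial Matrix

/-! ### The Hautus test -/

section Control

variable {ι κ : Type*} [Fintype ι]

/-- The Popov–Belevitch–Hautus condition: no left eigenvector of `A` over `ℂ` annihilates `B`;
equivalently, `[λI - A, B]` has full row rank for every complex `λ`. -/
def HautusCondition (A : Matrix ι ι ℝ) (B : Matrix ι κ ℝ) : Prop :=
  ∀ (lam : ℂ) (v : ι → ℂ), v ᵥ* A.map Complex.ofReal = lam • v →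
    v ᵥ* B.map Complex.ofReal = 0 → v = 0

theorem dotProduct_mulVec_ofReal [Fintype κ] {A : Matrix ι κ ℝ} (v : ι → ℂ) (x : κ → ℝ) :
    v ⬝ᵥ (fun i => ((A *ᵥ x) i : ℂ)) = (v ᵥ* A.map Complex.ofReal) ⬝ᵥ (fun i => (x i : ℂ)) := by
  rw [← dotProduct_mulVec]
  congr 1
  ext i
  simp [mulVec, dotProduct]

theorem hasDerivAt_dotProduct_ofReal (v : ι → ℂ) {x : ℝ → ι → ℝ} {x' : ι → ℝ} {t : ℝ}
    (h : HasDerivAt x x' t) :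
    HasDerivAt (fun s => v ⬝ᵥ (fun i => (x s i : ℂ))) (v ⬝ᵥ (fun i => (x' i : ℂ))) t := by
  simp only [dotProduct]
  refine HasDerivAt.fun_sum fun i _ => ?_
  exact ((hasDerivAt_pi.1 h i).ofReal_comp).const_mul (v i)

/-- A left eigenvector `v` with `v B = 0` makes `exp (-λ t) v x(t)` a constant of motion, so that from
`x 0 = 0` only the hyperplane `v x = 0` can be reached. -/
theorem Controllable.hautus [Fintype κ] {A : Matrix ι ι ℝ} {B : Matrix ι κ ℝ} (h : Controllable A B) :
    HautusCondition A B := by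
  intro lam v hA hB
  classical
  have key : ∀ x₁ : ι → ℝ, v ⬝ᵥ (fun i => (x₁ i : ℂ)) = 0 := by
    intro x₁
    obtain ⟨T, hT, u, x, hu, hx, h0, h1⟩ := h 0 x₁
    have hd : ∀ t, HasDerivAt
        (fun s : ℝ => Complex.exp (-lam * s) * v ⬝ᵥ (fun i => (x s i : ℂ))) 0 t := by
      intro t
      have h1 := hasDerivAt_dotProduct_ofReal v (hx t)
      have h2 : HasDerivAt (fun s : ℝ => Complex.exp (-lam * s))
          (Complex.exp (-lam * t) * (-lam * 1)) t :=
        (((hasDerivAt_id (t : ℂ)).const_mul (-lam)).cexp).comp_ofReal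
      have : v ⬝ᵥ (fun i => (((A *ᵥ x t + B *ᵥ u t) i : ℝ) : ℂ)) =
          lam * v ⬝ᵥ (fun i => (x t i : ℂ)) := by
        have e : (fun i => (((A *ᵥ x t + B *ᵥ u t) i : ℝ) : ℂ)) =
            (fun i => ((A *ᵥ x t) i : ℂ)) + (fun i => ((B *ᵥ u t) i : ℂ)) := by
          ext i; simp
        rw [e, dotProduct_add, dotProduct_mulVec_ofReal, dotProduct_mulVec_ofReal, hA, hB]
        simp
      have h3 := h2.mul h1
      rw [this] at h3
      have h4 : Complex.exp (-lam * t) * (-lam * 1) * v ⬝ᵥ (fun i => (x t i : ℂ)) +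
          Complex.exp (-lam * t) * (lam * v ⬝ᵥ (fun i => (x t i : ℂ))) = 0 := by ring
      rw [h4] at h3
      exact h3
    have hc := is_const_of_deriv_eq_zero (fun t => (hd t).differentiableAt)
      (fun t => (hd t).deriv) T 0
    rw [h1, h0] at hc
    simpa using hc
  ext i
  have := key (Pi.single i 1)
  simpa [dotProduct, Pi.single_apply, apply_ite Complex.ofReal] using this

/-- The complex vectors orthogonal (for the bilinear pairing) to the real vectors `x t k`, for all
times `t ∈ S` and all indices `k`. -/
def annihilator (x : ℝ → κ → ι → ℝ) (S : Set ℝ) : Submodule ℂ (ι → ℂ) where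
  carrier := {v | ∀ t ∈ S, ∀ k, v ⬝ᵥ (fun i => (x t k i : ℂ)) = 0}
  add_mem' := fun {a b} ha hb t ht k => by rw [add_dotProduct, ha t ht k, hb t ht k, add_zero]
  zero_mem' := fun t _ k => zero_dotProduct _
  smul_mem' := fun c v hv t ht k => by rw [smul_dotProduct, hv t ht k, smul_zero]

/-- The space orthogonal to the curves `x t k = exp (-t A) B e_k`, `0 < t < 1`, is invariant under `A`
(differentiate in `t`), so if it were nonzero it would contain a left eigenvector; letting `t → 0`,
that eigenvector would annihilate `B`. -/
theorem HautusCondition.eq_zero_of_orthogonal {A : Matrix ι ι ℝ} {B : Matrix ι κ ℝ}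
    (h : HautusCondition A B) {x : ℝ → κ → ι → ℝ}
    (hx : ∀ t k, HasDerivAt (fun s => x s k) (-(A *ᵥ x t k)) t)
    (hx0 : ∀ k, x 0 k = fun i => B i k) (v : ι → ℂ)
    (hv : ∀ t ∈ Set.Ioo (0 : ℝ) 1, ∀ k, v ⬝ᵥ (fun i => (x t k i : ℂ)) = 0) : v = 0 := by
  set S := annihilator x (Set.Ioo (0 : ℝ) 1) with hS
  let f : Module.End ℂ (ι → ℂ) := (A.map Complex.ofReal).vecMulLinear
  have hf : ∀ w ∈ S, f w ∈ S := by
    intro w hw t ht k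
    have h1 := hasDerivAt_dotProduct_ofReal w (hx t k)
    have h2 : HasDerivAt (fun s => w ⬝ᵥ (fun i => (x s k i : ℂ))) 0 t := by
      refine (hasDerivAt_const t (0 : ℂ)).congr_of_eventuallyEq ?_
      filter_upwards [Ioo_mem_nhds ht.1 ht.2] with s hs using hw s hs k
    have h3 := h1.unique h2
    change (w ᵥ* A.map Complex.ofReal) ⬝ᵥ _ = 0
    rw [← dotProduct_mulVec_ofReal]
    have e : (fun i => (((-(A *ᵥ x t k)) i : ℝ) : ℂ)) = -(fun i => ((A *ᵥ x t k) i : ℂ)) := by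
      ext i; simp
    rw [e, dotProduct_neg, neg_eq_zero] at h3
    exact h3
  by_contra hv0
  have : Nontrivial S := ⟨⟨⟨v, hv⟩, 0, fun e => hv0 (congrArg Subtype.val e)⟩⟩
  obtain ⟨lam, hlam⟩ := Module.End.exists_eigenvalue (f.restrict hf)
  obtain ⟨w, hw⟩ := hlam.exists_hasEigenvector
  refine hw.2 (Subtype.ext (h lam w ?_ ?_))
  · exact congrArg Subtype.val hw.apply_eq_smul
  · ext k
    have hcont : Continuous (fun s => (w : ι → ℂ) ⬝ᵥ (fun i => (x s k i : ℂ))) :=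
      continuous_iff_continuousAt.2 fun t =>
        (hasDerivAt_dotProduct_ofReal _ (hx t k)).continuousAt
    have h0 : (0 : ℝ) ∈ closure (Set.Ioo (0 : ℝ) 1) := by
      rw [closure_Ioo (by norm_num)]; simp
    have := Set.EqOn.closure (s := Set.Ioo (0 : ℝ) 1) (fun t ht => w.2 t ht k) hcont
      continuous_const h0
    simpa [hx0, vecMul] using this

/-- By variation of constants it is enough that `u ↦ ∫₀¹ exp (-s A) B u(s) ds` is onto. A functional
`f` vanishing on its range is tested against the input `u(s) = (f ∘ exp (-s A) B)ᵀ`. -/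
theorem HautusCondition.controllable [Fintype κ] {A : Matrix ι ι ℝ} {B : Matrix ι κ ℝ}
    (h : HautusCondition A B) : Controllable A B := by
  classical
  let a : (ι → ℝ) →L[ℝ] (ι → ℝ) := LinearMap.toContinuousLinearMap A.mulVecLin
  let b : (κ → ℝ) →L[ℝ] (ι → ℝ) := LinearMap.toContinuousLinearMap B.mulVecLin
  have ha : ∀ x, a x = A *ᵥ x := fun x => rfl
  have hb : ∀ x, b x = B *ᵥ x := fun x => rfl
  let E : ℝ → ((ι → ℝ) →L[ℝ] (ι → ℝ)) := fun t => NormedSpace.exp (t • a)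
  have hE : ∀ t, HasDerivAt E (a * E t) t := fun t => hasDerivAt_exp_smul_const' a t
  have hE0 : E 0 = 1 := by simp [E]
  have hEneg : ∀ t, E t * E (-t) = 1 := by
    intro t
    have hc : Commute (t • a) ((-t) • a) := ((Commute.refl a).smul_left _).smul_right _
    let : NormedAlgebra ℚ ((ι → ℝ) →L[ℝ] (ι → ℝ)) := NormedAlgebra.restrictScalars ℚ ℝ _
    change NormedSpace.exp (t • a) * NormedSpace.exp ((-t) • a) = 1
    rw [← NormedSpace.exp_add_of_commute hc, ← add_smul, add_neg_cancel, zero_smul,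
      NormedSpace.exp_zero]
  have hEcont : Continuous E := continuous_iff_continuousAt.2 fun t => (hE t).continuousAt
  have hEn : ∀ t, HasDerivAt (fun s => E (-s)) (-(a * E (-t))) t := by
    intro t
    have h1 := (hE (-t)).scomp t (hasDerivAt_neg t)
    rw [neg_one_smul] at h1
    exact h1
  have hInt : ∀ u : C(ℝ, κ → ℝ), Continuous fun s => E (-s) (b (u s)) := fun u =>
    (hEcont.comp continuous_neg).clm_apply (b.continuous.comp u.continuous)
  let R : C(ℝ, κ → ℝ) →ₗ[ℝ] (ι → ℝ) :=
    { toFun := fun u => ∫ s in (0 : ℝ)..1, E (-s) (b (u s))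
      map_add' := fun u v => by
        rw [← intervalIntegral.integral_add ((hInt u).intervalIntegrable _ _)
          ((hInt v).intervalIntegrable _ _)]
        simp
      map_smul' := fun c u => by
        rw [RingHom.id_apply, ← intervalIntegral.integral_smul]
        simp }
  have hR : Function.Surjective R := by
    rw [← LinearMap.range_eq_top]
    by_contra hne
    obtain ⟨f, hf, hker⟩ := Submodule.exists_le_ker_of_lt_top _ (lt_top_iff_ne_top.2 hne)
    let x : ℝ → κ → ι → ℝ := fun t k => E (-t) (b (Pi.single k 1))
    have hx : ∀ t k, HasDerivAt (fun s => x s k) (-(A *ᵥ x t k)) t := fun t k => by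
      have h1 := (hEn t).clm_apply (hasDerivAt_const t (b (Pi.single k 1)))
      rw [map_zero, add_zero] at h1
      exact h1
    have hxc : ∀ k, Continuous fun t => x t k := fun k =>
      continuous_iff_continuousAt.2 fun t => (hx t k).continuousAt
    let fc : (ι → ℝ) →L[ℝ] ℝ := LinearMap.toContinuousLinearMap f
    have hfx : ∀ k, Continuous fun t => f (x t k) := fun k => fc.continuous.comp (hxc k)
    let u : C(ℝ, κ → ℝ) := ⟨fun t k => f (x t k), continuous_pi hfx⟩
    have hu : ∀ t, f (E (-t) (b (u t))) = ∑ k, f (x t k) ^ 2 := by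
      intro t
      have : u t = ∑ k, f (x t k) • (Pi.single k 1 : κ → ℝ) := by
        ext k
        simp [u, Finset.sum_apply, Pi.single_apply]
      rw [this]
      simp [map_sum, x, sq]
    -- The value of `f` at the image of `u` is the integral of a sum of squares.
    have h0 : (∫ t in (0 : ℝ)..1, ∑ k, f (x t k) ^ 2) = 0 := by
      have h1 : f (R u) = 0 := hker ⟨u, rfl⟩
      have h2 := fc.intervalIntegral_comp_comm (μ := MeasureTheory.volume)
        ((hInt u).intervalIntegrable 0 1)
      simp_rw [← hu]
      exact h2.trans h1
    have hcont : Continuous fun t => ∑ k, f (x t k) ^ 2 :=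
      continuous_finsetSum _ fun k _ => (hfx k).pow 2
    have hzero : ∀ t ∈ Set.Ioo (0 : ℝ) 1, ∀ k, f (x t k) = 0 := by
      intro t ht k
      by_contra hne
      have hpos : 0 < ∫ t in (0 : ℝ)..1, ∑ k, f (x t k) ^ 2 :=
        intervalIntegral.integral_pos one_pos hcont.continuousOn
          (fun s _ => Finset.sum_nonneg fun k _ => sq_nonneg _)
          ⟨t, ⟨ht.1.le, ht.2.le⟩, Finset.sum_pos' (fun k _ => sq_nonneg _)
            ⟨k, Finset.mem_univ _, by positivity⟩⟩
      exact hpos.ne' h0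
    have hfsum : ∀ y : ι → ℝ, f y = ∑ i, f (Pi.single i 1) * y i := by
      intro y
      conv_lhs => rw [pi_eq_sum_univ' y]
      simp [map_sum, mul_comm]
    have hv := h.eq_zero_of_orthogonal hx (fun k => by
        simp only [x, neg_zero, hE0, hb, one_apply_eq_self, mulVec_single_one]
        rfl)
      (fun i => (f (Pi.single i 1) : ℂ)) (fun t ht k => by
        have := hzero t ht k
        rw [hfsum] at this
        simp only [dotProduct]
        exact_mod_cast this)
    refine hf (LinearMap.ext fun y => ?_)
    rw [hfsum]
    refine Finset.sum_eq_zero fun i _ => ?_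
    have : f (Pi.single i 1) = 0 := Complex.ofReal_eq_zero.1 (congrFun hv i)
    rw [this, zero_mul]
  intro x₀ x₁
  obtain ⟨u, hu⟩ := hR (E (-1) x₁ - x₀)
  refine ⟨1, one_pos, u, fun t => E t (x₀ + ∫ s in (0 : ℝ)..t, E (-s) (b (u s))), u.continuous,
    fun t => ?_, by simp [hE0], ?_⟩
  · have h1 : HasDerivAt (fun t => x₀ + ∫ s in (0 : ℝ)..t, E (-s) (b (u s)))
        (E (-t) (b (u t))) t :=
      ((hInt u).integral_hasStrictDerivAt 0 t).hasDerivAt.const_add x₀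
    have h2 := (hE t).clm_apply h1
    have h3 : E t (E (-t) (b (u t))) = b (u t) := by
      rw [← mul_apply_eq_comp, hEneg, one_apply_eq_self]
    rw [h3] at h2
    exact h2
  · have h1 : R u = ∫ s in (0 : ℝ)..1, E (-s) (b (u s)) := rfl
    change E 1 (x₀ + ∫ s in (0 : ℝ)..1, E (-s) (b (u s))) = x₁
    rw [← h1, hu, add_sub_cancel, ← mul_apply_eq_comp, hEneg,
      one_apply_eq_self]

theorem controllable_iff_hautus [Fintype κ] {A : Matrix ι ι ℝ} {B : Matrix ι κ ℝ} :
    Controllable A B ↔ HautusCondition A B :=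
  ⟨Controllable.hautus, HautusCondition.controllable⟩

end Control

/-! ### Row rank and maximal minors -/

section MinorRank

variable {ι κ F : Type*} [Fintype ι] [Fintype κ] [Field F]

theorem rank_eq_card_iff_vecMul {M : Matrix ι κ F} :
    M.rank = Fintype.card ι ↔ ∀ v, v ᵥ* M = 0 → v = 0 := by
  have h1 : (∀ v, v ᵥ* M = 0 → v = 0) ↔ LinearIndependent F M.row := by
    rw [← vecMul_injective_iff]
    exact (injective_iff_map_eq_zero M.vecMulLinear).symm
  rw [h1, linearIndependent_iff_card_eq_finrank_span, Set.finrank, ← rank_eq_finrank_span_row]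
  exact eq_comm

theorem exists_submatrix_det_ne_zero_iff [DecidableEq ι] {M : Matrix ι κ F} :
    (∃ f : ι ↪ κ, (M.submatrix id f).det ≠ 0) ↔ ∀ v, v ᵥ* M = 0 → v = 0 := by
  classical
  constructor
  · rintro ⟨f, hf⟩ v hv
    by_contra hne
    refine hf (exists_vecMul_eq_zero_iff.1 ⟨v, hne, ?_⟩)
    ext i
    exact congrFun hv (f i)
  · intro h
    obtain ⟨κ', a, ha, hspan, hli⟩ := exists_linearIndependent' F M.col
    have htop : Submodule.span F (Set.range M.col) = ⊤ := by
      apply Submodule.eq_top_of_finrank_eq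
      rw [← rank_eq_finrank_span_cols, rank_eq_card_iff_vecMul.2 h, Module.finrank_fintype_fun_eq_card]
    let b : Module.Basis κ' F (ι → F) := Module.Basis.mk hli (by rw [hspan, htop])
    let e : ι ≃ κ' := (Pi.basisFun F ι).indexEquiv b
    refine ⟨⟨a ∘ e, ha.comp e.injective⟩, ?_⟩
    have h2 : LinearIndependent F (M.submatrix id (a ∘ e)).col := hli.comp e e.injective
    rw [linearIndependent_cols_iff_isUnit, isUnit_iff_isUnit_det] at h2
    exact h2.ne_zero

end MinorRank

/-! ### Krylov matrices -/

section Krylov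

variable {N : ℕ} {R S : Type*} [CommRing R] [CommRing S]

/-- The Krylov matrix `[e, L e, …, L^(N-1) e]` of the unit vector `e = e_j`. -/
def krylov (L : Matrix (Fin N) (Fin N) R) (j : Fin N) : Matrix (Fin N) (Fin N) R :=
  Matrix.of fun i k => (L ^ (k : ℕ)) i j

theorem krylov_map (g : R →+* S) (L : Matrix (Fin N) (Fin N) R) (j : Fin N) :
    (krylov L j).map g = krylov (L.map g) j := by
  ext i k
  simp only [krylov, map_apply, of_apply, ← Matrix.map_pow]

theorem det_krylov_map (g : R →+* S) (L : Matrix (Fin N) (Fin N) R) (j : Fin N) :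
    g (krylov L j).det = (krylov (L.map g) j).det := by
  rw [RingHom.map_det, RingHom.mapMatrix_apply, krylov_map]

/-- Multiplying the Krylov matrix by the matrix `X` of left eigenvectors gives a diagonal matrix times
a Vandermonde matrix. The eigenvectors are not assumed independent: this follows. -/
theorem det_krylov_ne_zero_of_left_eigenvectors [IsDomain R] {L : Matrix (Fin N) (Fin N) R} {j : Fin N}
    {mu : Fin N → R} (hmu : Function.Injective mu) {X : Matrix (Fin N) (Fin N) R}
    (hX : ∀ i, X i ᵥ* L = mu i • X i) (hX0 : ∀ i, X i j ≠ 0) : (krylov L j).det ≠ 0 := by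
  have hpow : ∀ i (k : ℕ), X i ᵥ* L ^ k = mu i ^ k • X i := by
    intro i k
    induction k with
    | zero => simp
    | succ k ih => rw [pow_succ, ← vecMul_vecMul, ih, smul_vecMul, hX, smul_smul, pow_succ]
  have h : X * krylov L j = diagonal (fun i => X i j) * vandermonde mu := by
    ext i k
    rw [diagonal_mul, vandermonde_apply]
    have := congrFun (hpow i k) j
    rw [Pi.smul_apply, smul_eq_mul, mul_comm] at this
    exact this
  have hd := congrArg det h
  rw [det_mul, det_mul, det_diagonal] at hd
  intro h0
  rw [h0, mul_zero] at hd
  exact mul_ne_zero (Finset.prod_ne_zero_iff.2 fun i _ => hX0 i)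
    (det_vandermonde_ne_zero_iff.2 hmu) hd.symm

/-- The row space of `Y` is contained in its image under `L`, hence equal to it, hence `L`-invariant;
as it is orthogonal to `e_j`, it is orthogonal to all columns of the Krylov matrix. -/
theorem eq_zero_of_eq_mul_mul {r : ℕ} {F : Type*} [Field F] {L : Matrix (Fin N) (Fin N) F} {j : Fin N}
    (hL : (krylov L j).det ≠ 0) {H : Matrix (Fin r) (Fin r) F} {Y : Matrix (Fin r) (Fin N) F}
    (hY : Y = H * Y * L) (hj : ∀ a, Y a j = 0) : Y = 0 := by
  let S : Submodule F (Fin N → F) := LinearMap.range Y.vecMulLinear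
  have hle : S ≤ S.map L.vecMulLinear := by
    rintro _ ⟨z, rfl⟩
    refine ⟨(z ᵥ* H) ᵥ* Y, ⟨z ᵥ* H, rfl⟩, ?_⟩
    change ((z ᵥ* H) ᵥ* Y) ᵥ* L = z ᵥ* Y
    rw [vecMul_vecMul, vecMul_vecMul, ← Matrix.mul_assoc, ← hY]
  have heq : S = S.map L.vecMulLinear :=
    Submodule.eq_of_le_of_finrank_le hle (Submodule.finrank_map_le _ _)
  have hinv : ∀ x ∈ S, x ᵥ* L ∈ S := fun x hx => by
    rw [heq]; exact Submodule.mem_map_of_mem hx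
  have hpow : ∀ k : ℕ, ∀ x ∈ S, x ᵥ* L ^ k ∈ S := by
    intro k
    induction k with
    | zero => intro x hx; simpa using hx
    | succ k ih => intro x hx; rw [pow_succ, ← vecMul_vecMul]; exact hinv _ (ih x hx)
  have hS : ∀ x ∈ S, x j = 0 := by
    rintro _ ⟨z, rfl⟩
    change z ⬝ᵥ (fun a => Y a j) = 0
    simp [dotProduct, hj]
  have hzero : ∀ x ∈ S, x = 0 := by
    intro x hx
    by_contra hne
    refine hL (exists_vecMul_eq_zero_iff.1 ⟨x, hne, ?_⟩)
    ext k
    exact hS _ (hpow k x hx)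
  ext a i
  have := congrFun (hzero _ ⟨Pi.single a 1, rfl⟩) i
  simpa using this

end Krylov

/-! ### Left kernels of the networked system -/

section Network

variable {N n r : ℕ} {R S : Type*} [CommRing R] [CommRing S]

theorem sysA_const (A : Matrix (Fin n) (Fin n) R) (B : Matrix (Fin n) (Fin r) R)
    (C : Matrix (Fin r) (Fin n) R) (L : Matrix (Fin N) (Fin N) R) :
    sysA A B C (fun _ => L) = (1 : Matrix (Fin N) (Fin N) R) ⊗ₖ A - L ⊗ₖ (B * C) := by
  ext ⟨i, a⟩ ⟨j, b⟩
  simp [sysA, Matrix.sub_apply, Matrix.sum_apply, mul_apply, vecMulVec_apply, Finset.mul_sum]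

theorem sysA_map (g : R →+* S) (A : Matrix (Fin n) (Fin n) R) (B : Matrix (Fin n) (Fin r) R)
    (C : Matrix (Fin r) (Fin n) R) (L : Matrix (Fin N) (Fin N) R) :
    (sysA A B C fun _ => L).map g = sysA (A.map g) (B.map g) (C.map g) fun _ => L.map g := by
  ext ⟨i, a⟩ ⟨j, b⟩
  simp [sysA_const, mul_apply, one_apply, apply_ite g]

theorem sysB_map (g : R →+* S) (I : Finset (Fin N)) (B : Matrix (Fin n) (Fin r) R) :
    (sysB I B).map g = sysB I (B.map g) := by
  ext ⟨i, a⟩ ⟨j, b⟩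
  simp [sysB, inputSelector, apply_ite g]

theorem laplacian_map (g : R →+* S) (G : Digraph (Fin N)) (w : Edge G → R) :
    (laplacian G w).map g = laplacian G (g ∘ w) := by
  have h : ∀ i j, g (weight G w i j) = weight G (g ∘ w) i j := by
    intro i j
    unfold weight
    split_ifs <;> simp
  ext i j
  simp [laplacian, apply_ite g, h]

/-- The matrix `[λ I - A_sys, B_sys]`. -/
def hautusMatrix (A : Matrix (Fin n) (Fin n) R) (B : Matrix (Fin n) (Fin r) R)
    (C : Matrix (Fin r) (Fin n) R) (I : Finset (Fin N)) (L : Matrix (Fin N) (Fin N) R) (lam : R) :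
    Matrix (Fin N × Fin n) ((Fin N × Fin n) ⊕ ({i : Fin N // i ∈ I} × Fin r)) R :=
  fromCols (scalar _ lam - sysA A B C fun _ => L) (sysB I B)

theorem hautusMatrix_map (g : R →+* S) (A : Matrix (Fin n) (Fin n) R) (B : Matrix (Fin n) (Fin r) R)
    (C : Matrix (Fin r) (Fin n) R) (I : Finset (Fin N)) (L : Matrix (Fin N) (Fin N) R) (lam : R) :
    (hautusMatrix A B C I L lam).map g =
      hautusMatrix (A.map g) (B.map g) (C.map g) I (L.map g) (g lam) := by
  unfold hautusMatrix
  rw [← sysA_map, ← sysB_map]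
  ext i (j | j)
  · simp [diagonal_apply, apply_ite g]
  · simp

theorem vecMul_hautusMatrix_eq_zero_iff {A : Matrix (Fin n) (Fin n) R} {B : Matrix (Fin n) (Fin r) R}
    {C : Matrix (Fin r) (Fin n) R} {I : Finset (Fin N)} {L : Matrix (Fin N) (Fin N) R} {lam : R}
    {v : Fin N × Fin n → R} :
    v ᵥ* hautusMatrix A B C I L lam = 0 ↔
      v ᵥ* (sysA A B C fun _ => L) = lam • v ∧ v ᵥ* sysB I B = 0 := by
  have h : v ᵥ* scalar (Fin N × Fin n) lam = lam • v := by
    ext i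
    simp [scalar_apply, vecMul_diagonal, mul_comm]
  rw [hautusMatrix, vecMul_fromCols, vecMul_sub, h, ← Sum.elim_zero_zero, Sum.elim_eq_iff,
    sub_eq_zero]
  exact and_congr_left fun _ => eq_comm

/-- If the Krylov matrix of `L` at a driving vertex is nonsingular, then all uncontrollable modes are
eigenvalues of `A`. -/
theorem eq_zero_of_vecMul_hautusMatrix {F : Type*} [Field F] {A : Matrix (Fin n) (Fin n) F}
    {B : Matrix (Fin n) (Fin r) F} {C : Matrix (Fin r) (Fin n) F} {I : Finset (Fin N)}
    {L : Matrix (Fin N) (Fin N) F} {root : Fin N} (hroot : root ∈ I)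
    (hL : (krylov L root).det ≠ 0) {lam : F} (hlam : A.charpoly.eval lam ≠ 0)
    (v : Fin N × Fin n → F) (hv : v ᵥ* hautusMatrix A B C I L lam = 0) : v = 0 := by
  obtain ⟨hA, hB⟩ := vecMul_hautusMatrix_eq_zero_iff.1 hv
  obtain ⟨X, rfl⟩ := vec_bijective.2 v
  have hB' : ∀ a, (Bᵀ * X) a root = 0 := by
    rw [sysB, vec_vecMul_kronecker, vec_eq_zero_iff] at hB
    intro a
    have := congrFun (congrFun hB a) ⟨root, hroot⟩
    simpa [mul_apply, inputSelector] using this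
  rw [sysA_const, vecMul_sub, vec_vecMul_kronecker, vec_vecMul_kronecker, ← vec_sub, ← vec_smul,
    vec_inj, Matrix.mul_one, transpose_mul] at hA
  -- The kernel equation now reads `(λ - Aᵀ) X = -Cᵀ Bᵀ X L`, with `λ - Aᵀ` invertible.
  set P : Matrix (Fin n) (Fin n) F := scalar _ lam - Aᵀ with hP
  have hPdet : IsUnit P.det := by
    have : P = (scalar _ lam - A)ᵀ := by
      simp [hP, transpose_sub]
    rw [this, det_transpose, ← eval_charpoly]
    exact hlam.isUnit
  have hPX : P * X = -(Cᵀ * Bᵀ * X * L) := by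
    rw [hP, Matrix.sub_mul, scalar_apply, ← smul_one_eq_diagonal, Matrix.smul_mul, Matrix.one_mul,
      ← hA]
    abel
  have hX : X = P⁻¹ * -(Cᵀ * Bᵀ * X * L) := by
    rw [← hPX, ← Matrix.mul_assoc, nonsing_inv_mul _ hPdet, Matrix.one_mul]
  have hY : Bᵀ * X = -(Bᵀ * P⁻¹ * Cᵀ) * (Bᵀ * X) * L := by
    conv_lhs => rw [hX]
    simp only [Matrix.mul_neg, Matrix.neg_mul, Matrix.mul_assoc]
  have hY0 := eq_zero_of_eq_mul_mul hL hY hB'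
  rw [hX, Matrix.mul_assoc Cᵀ, hY0]
  simp

end Network

/-! ### Laplacians of trees -/

section SpanningTree

variable {N : ℕ} {F : Type*} [Field F]

/-- For a Laplacian `L` with rows `w_i (e_i - e_{par i})`, the equation `z (L - μ) = e_i` is solved
recursively along the path from `i` to the root, provided that `μ` is not the weight of a vertex on
that path. The depth `d` bounds the path. -/
theorem exists_resolvent_vector {L : Matrix (Fin N) (Fin N) F} {root : Fin N} {par : Fin N → Fin N}
    {d : Fin N → ℕ} (hd : ∀ i, i ≠ root → d (par i) < d i) {w : Fin N → F}
    (hw0 : w root = 0) (hw : ∀ i, i ≠ root → w i ≠ 0)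
    (hL : ∀ i, L i = w i • (Pi.single i 1 - Pi.single (par i) 1)) (mu : F) (i : Fin N)
    (hmu : ∀ j, d j ≤ d i → w j ≠ mu) (hmu0 : mu ≠ 0):
    ∃ z : Fin N → F, z ᵥ* L - mu • z = Pi.single i 1 ∧ z root ≠ 0 := by
  induction hk : d i using Nat.strong_induction_on generalizing i with
  | _ k ih =>
  subst hk
  by_cases hi : i = root
  · subst hi
    refine ⟨Pi.single i (-mu⁻¹), ?_, by simpa using hmu0⟩
    have h0 : L i = 0 := by rw [hL, hw0, zero_smul]
    ext j
    by_cases hj : j = i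
    · subst hj; simp [row, h0, hmu0]
    · simp [row, h0, hj]
  · obtain ⟨z, hz, hz0⟩ := ih (d (par i)) (hd i hi) (par i)
      (fun j hj => hmu j (hj.trans (hd i hi).le)) rfl
    have hne : w i - mu ≠ 0 := sub_ne_zero.2 (hmu i le_rfl)
    refine ⟨(w i - mu)⁻¹ • (Pi.single i 1 + w i • z), ?_, ?_⟩
    · have h1 : (Pi.single i 1 : Fin N → F) ᵥ* L = L i := by simp [row]
      have h2 : z ᵥ* L = Pi.single (par i) 1 + mu • z := by rw [← hz]; abel
      rw [smul_vecMul, add_vecMul, smul_vecMul, h1, hL, h2]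
      ext j
      simp only [Pi.sub_apply, Pi.smul_apply, Pi.add_apply, smul_eq_mul]
      field_simp
      ring
    · simp only [Pi.smul_apply, Pi.add_apply, smul_eq_mul, Pi.single_apply, if_neg (Ne.symm hi),
        zero_add]
      exact mul_ne_zero (inv_ne_zero hne) (mul_ne_zero (hw i hi) hz0)

/-- The left eigenvector of `w_i` is `e_i` plus a multiple of the solution of
`z (L - w_i) = e_{par i}`, since `e_i (L - w_i) = -w_i e_{par i}`. -/
theorem det_krylov_tree_ne_zero {L : Matrix (Fin N) (Fin N) F} {root : Fin N} {par : Fin N → Fin N}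
    {d : Fin N → ℕ} (hd : ∀ i, i ≠ root → d (par i) < d i) {w : Fin N → F}
    (hw0 : w root = 0) (hw : Function.Injective w)
    (hL : ∀ i, L i = w i • (Pi.single i 1 - Pi.single (par i) 1)) : (krylov L root).det ≠ 0 := by
  have hne : ∀ i, i ≠ root → w i ≠ 0 := fun i hi h => hi (hw (h.trans hw0.symm))
  have hvec : ∀ i, ∃ x : Fin N → F, x ᵥ* L = w i • x ∧ x root ≠ 0 := by
    intro i
    by_cases hi : i = root
    · subst hi
      refine ⟨Pi.single i 1, ?_, by simp⟩
      ext j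
      simp [row, hL, hw0]
    · obtain ⟨z, hz, hz0⟩ := exists_resolvent_vector hd hw0 hne hL (w i) (par i)
        (fun j hj h => hj.not_gt ((hw h).symm ▸ hd i hi)) (hne i hi)
      refine ⟨Pi.single i 1 + w i • z, ?_, ?_⟩
      · have h1 : (Pi.single i 1 : Fin N → F) ᵥ* L = L i := by simp [row]
        have h2 : z ᵥ* L = Pi.single (par i) 1 + w i • z := by rw [← hz]; abel
        rw [add_vecMul, smul_vecMul, h1, hL, h2]
        ext j
        simp only [Pi.sub_apply, Pi.smul_apply, Pi.add_apply, smul_eq_mul]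
        ring
      · simp only [Pi.smul_apply, Pi.add_apply, smul_eq_mul, Pi.single_apply, if_neg (Ne.symm hi),
          zero_add]
        exact mul_ne_zero (hne i hi) hz0
  choose X hX hX0 using hvec
  exact det_krylov_ne_zero_of_left_eigenvectors (X := Matrix.of X) hw hX hX0

/-- If all vertices can be reached from `root`, then parents can be chosen along shortest paths; `d` is
the distance from `root`. -/
theorem exists_parent {V : Type*} {r : V → V → Prop} {root : V}
    (h : ∀ v, Relation.ReflTransGen r root v) :
    ∃ (par : V → V) (d : V → ℕ), ∀ v, v ≠ root → r (par v) v ∧ d (par v) < d v := by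
  classical
  -- `W k v`: there is a walk of length `k` from `root` to `v`.
  let W : ℕ → V → Prop := fun k => k.rec (fun v => v = root) fun _ P v => ∃ u, P u ∧ r u v
  have hW : ∀ v, ∃ k, W k v := by
    intro v
    induction h v with
    | refl => exact ⟨0, rfl⟩
    | tail _ huv ih => exact ih.elim fun k hk => ⟨k + 1, _, hk, huv⟩
  let d : V → ℕ := fun v => @Nat.find (fun k => W k v) (fun _ => Classical.dec _) (hW v)
  have hpar : ∀ v, ∃ u, v ≠ root → r u v ∧ d u < d v := by
    intro v
    have hv : W (d v) v := @Nat.find_spec (fun k => W k v) (fun _ => Classical.dec _) (hW v)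
    rcases hdv : d v with _ | k
    · rw [hdv] at hv
      exact ⟨v, fun hne => absurd hv hne⟩
    · rw [hdv] at hv
      obtain ⟨u, hu, huv⟩ := hv
      exact ⟨u, fun _ => ⟨huv, Nat.lt_succ_of_le
        (@Nat.find_min' (fun k => W k u) (fun _ => Classical.dec _) (hW u) _ hu)⟩⟩
  choose par hpar using hpar
  exact ⟨par, d, hpar⟩

theorem exists_weight_det_krylov_ne_zero (F : Type*) [Field F] [CharZero F] {G : Digraph (Fin N)}
    {root : Fin N} (h : ∀ v, Relation.ReflTransGen G.Adj root v) :
    ∃ w : Edge G → F, (krylov (laplacian G w) root).det ≠ 0 := by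
  classical
  obtain ⟨par, d, hpar⟩ := exists_parent h
  let w : Fin N → F := fun i => if i = root then 0 else ((i : ℕ) : F) + 1
  have hw : Function.Injective w := by
    intro i j hij
    have hpos : ∀ k : ℕ, (k : F) + 1 ≠ 0 := fun k => Nat.cast_add_one_ne_zero k
    simp only [w] at hij
    split_ifs at hij with hi hj hj
    · exact hi.trans hj.symm
    · exact absurd hij.symm (hpos _)
    · exact absurd hij (hpos _)
    · exact Fin.ext (Nat.cast_injective (add_right_cancel hij))
  have hw0 : w root = 0 := if_pos rfl
  let p : Edge G → F := fun e => if e.1.1 = par e.1.2 then w e.1.2 else 0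
  have hweight : ∀ i j, weight G p i j = if j = par i then w i else 0 := by
    intro i j
    unfold weight
    by_cases hadj : G.Adj j i
    · simp [hadj, p]
    · rw [dif_neg hadj]
      split_ifs with hj
      · subst hj
        by_cases hi : i = root
        · rw [hi, hw0]
        · exact absurd (hpar i hi).1 hadj
      · rfl
  refine ⟨p, det_krylov_tree_ne_zero (fun i hi => (hpar i hi).2) hw0 hw fun i => ?_⟩
  by_cases hi : i = root
  · have hz : ∀ j, weight G p i j = 0 := fun j => by rw [hweight, hi, hw0, ite_self]
    ext j
    subst hi
    simp [laplacian, hz, hw0]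
  · have hne : par i ≠ i := fun e => by
      have := (hpar i hi).2
      rw [e] at this
      exact lt_irrefl _ this
    ext j
    simp only [laplacian, of_apply, hweight, Pi.smul_apply, Pi.sub_apply, smul_eq_mul,
      Pi.single_apply]
    by_cases hij : i = j
    · subst hij
      simp [hne, hne.symm]
    · simp [hij, Ne.symm hij]

end SpanningTree

/-! ### Factors over `ℝ[s,p]` -/

section Factors

/-- Exchanging the roles of `s` and `p`, a divisor of a nonzero polynomial of degree zero in `p` has
itself degree zero in `p`. -/
theorem exists_eq_map_C_of_dvd_map_C {σ : Type*} {a : Polynomial (MvPolynomial σ ℝ)} {q : ℝ[X]}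
    (hq : q ≠ 0) (h : a ∣ q.map MvPolynomial.C) : ∃ b : ℝ[X], a = b.map MvPolynomial.C := by
  let e : Polynomial (MvPolynomial σ ℝ) ≃ₐ[ℝ] MvPolynomial σ ℝ[X] :=
    (MvPolynomial.optionEquivLeft ℝ σ).symm.trans (MvPolynomial.optionEquivRight ℝ σ)
  have heC : ∀ b : ℝ[X], e (b.map MvPolynomial.C) = MvPolynomial.C b := by
    intro b
    induction b using Polynomial.induction_on' with
    | add p q hp hq => rw [Polynomial.map_add, map_add, hp, hq, map_add]
    | monomial k c =>
      rw [← C_mul_X_pow_eq_monomial]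
      simp [e]
  obtain ⟨c, hc⟩ := h
  have hC : MvPolynomial.C q = e a * e c := by rw [← heC, hc, map_mul]
  have hne : e a * e c ≠ 0 := by
    rw [← hC]
    simpa using hq
  have hdeg := MvPolynomial.totalDegree_mul_of_isDomain (left_ne_zero_of_mul hne)
    (right_ne_zero_of_mul hne)
  rw [← hC, MvPolynomial.totalDegree_C] at hdeg
  have ha : (e a).totalDegree = 0 := by omega
  refine ⟨(e a).coeff 0, e.injective ?_⟩
  rw [heC]
  exact MvPolynomial.totalDegree_eq_zero_iff_eq_C.1 ha

theorem dvd_pow_natDegree_of_roots {K : Type*} [Field K] [IsAlgClosed K] {p q : K[X]} (hp : p.Monic)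
    (h : ∀ x, p.eval x = 0 → q.eval x = 0) : p ∣ q ^ p.natDegree := by
  have hs := IsAlgClosed.splits p
  rw [hs.natDegree_eq_card_roots]
  conv_lhs => rw [hs.eq_prod_roots_of_monic hp]
  rw [← Multiset.prod_replicate, ← Multiset.map_const']
  refine Multiset.prod_dvd_prod_of_dvd _ _ fun x hx => ?_
  rw [dvd_iff_isRoot]
  exact h x (isRoot_of_mem_roots hx)

/-- An `(s,p)`-factor `α` of a divisor of a monic polynomial has a root, over an algebraically closed
extension of `ℝ[p]`, that is not a root of a given real polynomial `q`. The leading coefficient of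
`α` is a unit; if all its roots were roots of `q`, then `α` would divide a power of `q` and so be a
polynomial in `s` alone. -/
theorem IsSPFactor.exists_root {σ : Type*} {α a : Polynomial (MvPolynomial σ ℝ)}
    (h : IsSPFactor α a) {p : Polynomial (MvPolynomial σ ℝ)} (hp : p.Monic) (hap : a ∣ p)
    {K : Type*} [Field K] [IsAlgClosed K] {g : MvPolynomial σ ℝ →+* K} (hg : Function.Injective g)
    {q : ℝ[X]} (hq : q ≠ 0) :
    ∃ x : K, α.eval₂ g x = 0 ∧ q.eval₂ (g.comp MvPolynomial.C) x ≠ 0 := by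
  by_contra! hcon
  obtain ⟨hα, hs, hu⟩ := h
  obtain ⟨u, hlc⟩ := hp.isUnit_leadingCoeff_of_dvd (hα.trans hap)
  have hassoc : Associated α (C (↑u⁻¹ : MvPolynomial σ ℝ) * α) :=
    
    associated_unit_mul_right α _ (isUnit_C.2 u⁻¹.isUnit)
  set β := C (↑u⁻¹ : MvPolynomial σ ℝ) * α with hβ
  have hβm : β.Monic := by
    rw [Monic, hβ, leadingCoeff_mul, leadingCoeff_C, ← hlc, Units.inv_mul]
  have hdvd : β ∣ (q ^ (β.map g).natDegree).map MvPolynomial.C := by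
    rw [← map_dvd_map g hg hβm, Polynomial.map_map, Polynomial.map_pow]
    refine dvd_pow_natDegree_of_roots (hβm.map g) fun x hx => ?_
    rw [eval_map]
    refine hcon x ?_
    rw [eval_map, hβ, eval₂_mul, eval₂_C] at hx
    exact (mul_eq_zero.1 hx).resolve_left
      ((map_ne_zero_iff g hg).2 u⁻¹.isUnit.ne_zero)
  obtain ⟨b, hb⟩ := exists_eq_map_C_of_dvd_map_C (pow_ne_zero _ hq) hdvd
  refine hs b ⟨hb ▸ hassoc.symm.dvd, ?_⟩
  by_contra hdeg
  have hβ0 : β.natDegree = 0 := by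
    rw [hb, natDegree_map_eq_of_injective (MvPolynomial.C_injective _ _)]
    omega
  exact hu (hassoc.symm.isUnit (hβm.natDegree_eq_zero.1 hβ0 ▸ isUnit_one))

end Factors

/-! ### Generic real weights -/

section GenericWeights

theorem exists_real_eval_ne_zero {σ J : Type*} (s : Finset J) (P : J → MvPolynomial σ ℂ)
    (hP : ∀ j ∈ s, P j ≠ 0) :
    ∃ w : σ → ℝ, ∀ j ∈ s, MvPolynomial.eval (Complex.ofReal ∘ w) (P j) ≠ 0 := by
  by_contra! hcon
  refine Finset.prod_ne_zero_iff.2 hP (MvPolynomial.funext_set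
    (fun _ => Set.range Complex.ofReal)
    (fun _ => Set.infinite_range_of_injective Complex.ofReal_injective) fun x hx => ?_)
  choose w hw using fun i => hx i trivial
  obtain ⟨j, hj, h0⟩ := hcon w
  rw [map_prod, map_zero]
  refine Finset.prod_eq_zero hj ?_
  rwa [show x = Complex.ofReal ∘ w from funext fun i => (hw i).symm]

end GenericWeights

/-! ### Modes of the networked system -/

section Main

variable {N n r : ℕ} {G : Digraph (Fin N)} {I : Finset (Fin N)} {A : Matrix (Fin n) (Fin n) ℝ}
  {B : Matrix (Fin n) (Fin r) ℝ} {C : Matrix (Fin r) (Fin n) ℝ} {root : Fin N}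

theorem HasSpanningTreeRootedAt.reachable (h : HasSpanningTreeRootedAt G root) (v : Fin N) :
    Relation.ReflTransGen G.Adj root v := by
  obtain ⟨T, hT, -, hreach⟩ := h
  exact Relation.ReflTransGen.mono (fun i j hij => hT (i, j) hij) _ _ (hreach v)

theorem det_krylov_generic_ne_zero (F : Type*) [Field F] [CharZero F]
    (h : ∀ v, Relation.ReflTransGen G.Adj root v) :
    (krylov (laplacian G (MvPolynomial.X : Edge G → MvPolynomial (Edge G) F)) root).det ≠ 0 := by
  obtain ⟨w, hw⟩ := exists_weight_det_krylov_ne_zero F h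
  intro h0
  apply hw
  have := congrArg (MvPolynomial.eval w) h0
  rw [det_krylov_map, laplacian_map, map_zero] at this
  convert this
  ext e
  simp

/-- Substituting `x` for `s` and `g p` for `p` in the pencil of the networked system. -/
theorem pencil_sysA_map {K : Type*} [CommRing K] (g : MvPolynomial (Edge G) ℝ →+* K) (x : K) :
    (pencil (sysA (A.map MvPolynomial.C) (B.map MvPolynomial.C) (C.map MvPolynomial.C)
      fun _ => laplacian G MvPolynomial.X) (sysB I (B.map MvPolynomial.C))).map (eval₂RingHom g x) =
    hautusMatrix (A.map (g.comp MvPolynomial.C)) (B.map (g.comp MvPolynomial.C))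
      (C.map (g.comp MvPolynomial.C)) I (laplacian G (g ∘ MvPolynomial.X)) x := by
  have hM : ∀ {l m : Type} (M : Matrix l m ℝ), M.map (g.comp MvPolynomial.C) =
      (M.map MvPolynomial.C).map g := fun M => by ext; simp
  rw [hM, hM, hM, ← laplacian_map, hautusMatrix, ← sysA_map g, ← sysB_map g]
  ext i (j | j)
  · by_cases hij : i = j
    · subst hij
      simp [pencil, scalar_apply]
    · simp [pencil, scalar_apply, hij]
  · simp [pencil]

theorem not_hasParamUncontrollableMode (hroot : root ∈ I)
    (h : ∀ v, Relation.ReflTransGen G.Adj root v) : ¬ HasParamUncontrollableMode G I A B C := by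
  rintro ⟨α, hα⟩
  let K := AlgebraicClosure (FractionRing (MvPolynomial (Edge G) ℝ))
  let g : MvPolynomial (Edge G) ℝ →+* K := (algebraMap (FractionRing (MvPolynomial (Edge G) ℝ)) K).comp
    (algebraMap (MvPolynomial (Edge G) ℝ) (FractionRing (MvPolynomial (Edge G) ℝ)))
  have hg : Function.Injective g := 
    (algebraMap (FractionRing (MvPolynomial (Edge G) ℝ)) K).injective.comp
      (IsFractionRing.injective (MvPolynomial (Edge G) ℝ) _)
  have hminor := (dvd_minorGcd_iff _ _).1 (dvd_refl (minorGcd (pencil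
    (sysA (A.map MvPolynomial.C) (B.map MvPolynomial.C) (C.map MvPolynomial.C)
      fun _ => laplacian G MvPolynomial.X) (sysB I (B.map (MvPolynomial.C (σ := Edge G)))))))
  obtain ⟨x, hx, hqx⟩ := hα.exists_root (charpoly_monic _) (hminor ⟨Sum.inl, Sum.inl_injective⟩) hg
    A.charpoly_monic.ne_zero
  have hL : (krylov (laplacian G (g ∘ MvPolynomial.X)) root).det ≠ 0 := by
    rw [← laplacian_map, ← det_krylov_map]
    exact (map_ne_zero_iff g hg).2 (det_krylov_generic_ne_zero ℝ h)
  rw [← eval_map, ← charpoly_map] at hqx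
  obtain ⟨f, hf⟩ := exists_submatrix_det_ne_zero_iff.2
    (eq_zero_of_vecMul_hautusMatrix (B := B.map (g.comp MvPolynomial.C))
      (C := C.map (g.comp MvPolynomial.C)) hroot hL hqx)
  apply hf
  rw [← pencil_sysA_map, submatrix_map, ← RingHom.mapMatrix_apply, ← RingHom.map_det]
  obtain ⟨c, hc⟩ := hα.1.trans (hminor f)
  rw [hc, map_mul, coe_eval₂RingHom, hx, zero_mul]

theorem modeMatrix_eq (lam : ℂ) (w : Edge G → ℝ) :
    modeMatrix G I A B C lam w = hautusMatrix (A.map Complex.ofReal) (B.map Complex.ofReal)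
      (C.map Complex.ofReal) I (laplacian G (Complex.ofReal ∘ w)) lam := by
  have hBC : (B * C).map Complex.ofReal = B.map Complex.ofReal * C.map Complex.ofReal :=
    Matrix.map_mul (f := Complex.ofRealHom)
  have hL : (laplacian G w).map Complex.ofReal = laplacian G (Complex.ofReal ∘ w) :=
    laplacian_map Complex.ofRealHom G w
  rw [modeMatrix, hautusMatrix, sysA_const, sysB, hBC, hL, scalar_apply, smul_one_eq_diagonal]
  congr 1
  abel

theorem hautusCondition_iff_modeMatrix (w : Edge G → ℝ) :
    HautusCondition (sysA A B C fun _ => laplacian G w) (sysB I B) ↔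
      ∀ lam v, v ᵥ* modeMatrix G I A B C lam w = 0 → v = 0 := by
  have hA : (sysA A B C fun _ => laplacian G w).map Complex.ofReal =
      sysA (A.map Complex.ofReal) (B.map Complex.ofReal) (C.map Complex.ofReal) fun _ =>
        laplacian G (Complex.ofReal ∘ w) := by
    have h1 := sysA_map Complex.ofRealHom A B C (laplacian G w)
    rw [laplacian_map] at h1
    exact h1
  have hB : (sysB I B).map Complex.ofReal = sysB I (B.map Complex.ofReal) :=
    sysB_map Complex.ofRealHom I B
  simp only [HautusCondition, hA, hB, modeMatrix_eq, vecMul_hautusMatrix_eq_zero_iff, and_imp]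

theorem genericRank_modeMatrix_eq_iff (lam : ℂ) :
    genericRank (modeMatrix G I A B C lam) = N * n ↔
      ∃ w, ∀ v, v ᵥ* modeMatrix G I A B C lam w = 0 → v = 0 := by
  have hcard : N * n = Fintype.card (Fin N × Fin n) := by simp
  simp only [hcard, ← rank_eq_card_iff_vecMul]
  constructor
  · intro h
    obtain ⟨w, hw⟩ := exists_rank_eq_genericRank (modeMatrix G I A B C lam)
    exact ⟨w, hw.trans h⟩
  · rintro ⟨w, hw⟩
    refine le_antisymm ?_ (hw ▸ rank_le_genericRank _ w)
    exact ciSup_le fun w => rank_le_card_height _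

/-- If full row rank is attained at some weights, then some maximal minor is a nonzero polynomial in
the weights, and full row rank holds wherever it does not vanish. -/
theorem exists_minor_polynomial {lam : ℂ}
    (h : genericRank (modeMatrix G I A B C lam) = N * n) :
    ∃ P : MvPolynomial (Edge G) ℂ, P ≠ 0 ∧ ∀ w : Edge G → ℝ,
      MvPolynomial.eval (Complex.ofReal ∘ w) P ≠ 0 →
        ∀ v, v ᵥ* modeMatrix G I A B C lam w = 0 → v = 0 := by
  obtain ⟨w₀, hw₀⟩ := (genericRank_modeMatrix_eq_iff lam).1 h
  obtain ⟨f, hf⟩ := exists_submatrix_det_ne_zero_iff.2 hw₀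
  let c : ℂ →+* MvPolynomial (Edge G) ℂ := MvPolynomial.C
  let M := hautusMatrix ((A.map Complex.ofReal).map c) ((B.map Complex.ofReal).map c)
    ((C.map Complex.ofReal).map c) I (laplacian G MvPolynomial.X) (c lam)
  have hM : ∀ w : Edge G → ℝ, MvPolynomial.eval (Complex.ofReal ∘ w) (M.submatrix id f).det =
      ((modeMatrix G I A B C lam w).submatrix id f).det := by
    intro w
    have hc : ∀ {l m : Type} (Z : Matrix l m ℂ),
        (Z.map c).map (MvPolynomial.eval (Complex.ofReal ∘ w)) = Z := fun Z => by
      ext; simp [c]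
    rw [RingHom.map_det, RingHom.mapMatrix_apply, ← submatrix_map, hautusMatrix_map, laplacian_map,
      hc, hc, hc, modeMatrix_eq]
    congr 4
    · ext e; simp
    · simp [c]
  refine ⟨(M.submatrix id f).det, fun h0 => hf ?_, fun w hw => ?_⟩
  · rw [← hM, h0, map_zero]
  · rw [hM] at hw
    exact exists_submatrix_det_ne_zero_iff.1 ⟨f, hw⟩

theorem structurallyControllable_of_genericRank (hroot : root ∈ I)
    (h : ∀ v, Relation.ReflTransGen G.Adj root v)
    (hrank : ∀ lam ∈ spectrum ℂ (A.map Complex.ofReal),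
      genericRank (modeMatrix G I A B C lam) = N * n) : StructurallyControllable G I A B C := by
  have hspec : ∀ lam, lam ∈ spectrum ℂ (A.map Complex.ofReal) ↔
      lam ∈ (A.map Complex.ofReal).charpoly.roots.toFinset := fun lam => by
    rw [mem_spectrum_iff_isRoot_charpoly, Multiset.mem_toFinset,
      mem_roots (charpoly_monic _).ne_zero]
  choose! P hP0 hP using fun lam hlam => exists_minor_polynomial (hrank lam hlam)
  let Q : Option ℂ → MvPolynomial (Edge G) ℂ := fun o =>
    o.elim (krylov (laplacian G MvPolynomial.X) root).det P
  obtain ⟨w, hw⟩ := exists_real_eval_ne_zero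
    (Finset.insertNone (A.map Complex.ofReal).charpoly.roots.toFinset) Q (by
      rintro (_ | lam) hlam
      · exact det_krylov_generic_ne_zero ℂ h
      · exact hP0 lam ((hspec lam).2 (Finset.some_mem_insertNone.1 hlam)))
  have hL : (krylov (laplacian G (Complex.ofReal ∘ w)) root).det ≠ 0 := by
    have := hw none (Finset.none_mem_insertNone)
    change MvPolynomial.eval _ (krylov (laplacian G MvPolynomial.X) root).det ≠ 0 at this
    rw [det_krylov_map, laplacian_map] at this
    convert this
    ext e
    simp
  refine ⟨w, controllable_iff_hautus.2 ((hautusCondition_iff_modeMatrix w).2 fun lam => ?_)⟩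
  by_cases hlam : lam ∈ spectrum ℂ (A.map Complex.ofReal)
  · exact hP lam hlam w (hw (some lam) (Finset.some_mem_insertNone.2 ((hspec lam).1 hlam)))
  · rw [mem_spectrum_iff_isRoot_charpoly] at hlam
    rw [modeMatrix_eq]
    exact eq_zero_of_vecMul_hautusMatrix hroot hL hlam

end Main

end NRCS

theorem proposition1 {N n r : ℕ} (G : Digraph (Fin N)) (hloop : ∀ i, ¬ G.Adj i i)
    (I : Finset (Fin N)) (A : Matrix (Fin n) (Fin n) ℝ) (B : Matrix (Fin n) (Fin r) ℝ)
    (C : Matrix (Fin r) (Fin n) ℝ)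
    (htree : ∃ root ∈ I, NRCS.HasSpanningTreeRootedAt G root) :
    ¬ NRCS.HasParamUncontrollableMode G I A B C ∧
      (NRCS.StructurallyControllable G I A B C ↔
        ∀ lam ∈ spectrum ℂ (A.map Complex.ofReal),
          NRCS.genericRank (NRCS.modeMatrix G I A B C lam) = N * n) := by
  obtain ⟨root, hroot, ht⟩ := htree
  refine ⟨NRCS.not_hasParamUncontrollableMode hroot ht.reachable, fun ⟨w, hw⟩ lam _ => ?_,
    NRCS.structurallyControllable_of_genericRank hroot ht.reachable⟩
  exact (NRCS.genericRank_modeMatrix_eq_iff lam).2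
    ⟨w, (NRCS.hautusCondition_iff_modeMatrix w).1 (NRCS.controllable_iff_hautus.1 hw) lam⟩
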